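/- Let $X_1,X_2,\dots$ be i.i.d. real random variables with common law $G$ (not necessarily symmetric). Let $k\ge 2$, assume $\int x^{4k}\,dG(x)<\infty$ and that $G$ is nondegenerate. Write $m_\ell=\int x^\ell\,dG(x)$, $\mu_\ell=\int (x-m_1)^\ell\,dG(x)$, $\sigma=\sqrt{\mu_2}>0$, $h_\ell(x)=x^\ell$. For $2\le p\le k$ put $$b_p=\frac{\mu_{2p-1}}{\sigma^{2p-1}},\qquad a_p=\frac{\mu_{2p}}{\sigma^{2p}},\qquad b_{n,p}=\frac{\mu_{n,2p-1}}{\mu_{n,2}^{(2p-1)/2}},\qquad a_{n,p}=\frac{\mu_{n,2p}}{\mu_{n,2}^{p}},$$ where $\mu_{n,\ell}=\frac1n\sum_{i=1}^n (X_i-\overline X)^\ell$ and $\overline X=\frac1n\sum_{i=1}^n X_i$ (with the convention that $b_{n,p}$ and $a_{n,p}$ are $0$ when $\mu_{n,2}=0$). Let $$A(\ell)=h_\ell+\sum_{q=0}^{\ell-1}\binom{\ell}{q}(-1)^{\ell-q}\left(m_1^{\ell-q}h_q+(\ell-q)\,m_1^{\ell-q-1}m_q\,h_1\right),$$ $$B(p)=\sigma^{-(2p-1)}\left(A(2p-1)-\tfrac{2p-1}{2}\,\sigma^{-2}\mu_{2p-1}A(2)\right),\qquad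 C(p)=\sigma^{-2p}\left(A(2p)-p\,\sigma^{-2}\mu_{2p}A(2)\right),$$ and let $aj(p)$, $bj(p)$ be the variances of $C(p)$ and $B(p)$ under $G$, $abj(p)$ the covariance of $C(p)$ and $B(p)$ under $G$, and $\Delta(p)=aj(p)\,bj(p)-abj(p)^2$. Then for every $p$ with $2\le p\le k$ and $\Delta(p)\ne 0$, $$\frac{n}{\Delta(p)}\Big(aj(p)(b_{n,p}-b_p)^2+bj(p)(a_{n,p}-a_p)^2-2\,abj(p)(b_{n,p}-b_p)(a_{n,p}-a_p)\Big)$$ converges in law, as $n\to\infty$, to the chi-square distribution $\chi^2_2$ with two degrees of freedom. -/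

import Mathlib

open MeasureTheory ProbabilityTheory Filter

namespace JarqueBera

noncomputable section

/-! ### Empirical quantities, for a sample `x 0, …, x (n - 1)` -/

/-- The empirical mean of the first `n` observations. -/
def sampleMean (x : ℕ → ℝ) (n : ℕ) : ℝ :=
  (1 / (n : ℝ)) * ∑ i ∈ Finset.range n, x i

/-- The centered empirical moment `μ_{n,ℓ}`. -/
def sampleCentralMoment (x : ℕ → ℝ) (n ℓ : ℕ) : ℝ :=
  (1 / (n : ℝ)) * ∑ i ∈ Finset.range n, (x i - sampleMean x n) ^ ℓ

/-- The odd normalized centered empirical moment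
`b_{n,p} = μ_{n,2p-1} / μ_{n,2}^{(2p-1)/2}`. -/
def bEmp (x : ℕ → ℝ) (n p : ℕ) : ℝ :=
  sampleCentralMoment x n (2 * p - 1) / √(sampleCentralMoment x n 2) ^ (2 * p - 1)

/-- The even normalized centered empirical moment `a_{n,p} = μ_{n,2p} / μ_{n,2}^p`. -/
def aEmp (x : ℕ → ℝ) (n p : ℕ) : ℝ :=
  sampleCentralMoment x n (2 * p) / sampleCentralMoment x n 2 ^ p

/-! ### Theoretical quantities, for a law `G` on the real line -/

/-- The moment `m_ℓ = ∫ x ^ ℓ dG(x)`. -/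
def mom (G : Measure ℝ) (ℓ : ℕ) : ℝ := moment id ℓ G

/-- The centered moment `μ_ℓ = ∫ (x - m_1) ^ ℓ dG(x)`. -/
def cmom (G : Measure ℝ) (ℓ : ℕ) : ℝ := centralMoment id ℓ G

/-- The standard deviation `σ`. -/
def sigma (G : Measure ℝ) : ℝ := √(cmom G 2)

/-- `b_p = μ_{2p-1} / σ^{2p-1}`. -/
def bCoef (G : Measure ℝ) (p : ℕ) : ℝ := cmom G (2 * p - 1) / sigma G ^ (2 * p - 1)

/-- `a_p = μ_{2p} / σ^{2p}`. -/
def aCoef (G : Measure ℝ) (p : ℕ) : ℝ := cmom G (2 * p) / sigma G ^ (2 * p)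

/-- The function `A(ℓ) = h_ℓ + ∑_{q < ℓ} C(ℓ, q) (-1)^{ℓ-q}
(m_1^{ℓ-q} h_q + (ℓ-q) m_1^{ℓ-q-1} m_q h_1)`, where `h_j(x) = x ^ j`. -/
def funA (G : Measure ℝ) (ℓ : ℕ) (x : ℝ) : ℝ :=
  x ^ ℓ + ∑ q ∈ Finset.range ℓ, (ℓ.choose q : ℝ) * (-1) ^ (ℓ - q) *
    (mom G 1 ^ (ℓ - q) * x ^ q
      + ((ℓ - q : ℕ) : ℝ) * mom G 1 ^ (ℓ - q - 1) * mom G q * x)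

/-- The function `B(p) = σ^{-(2p-1)} (A(2p-1) - (2p-1)/2 σ^{-2} μ_{2p-1} A(2))`. -/
def funB (G : Measure ℝ) (p : ℕ) (x : ℝ) : ℝ :=
  (sigma G ^ (2 * p - 1))⁻¹ *
    (funA G (2 * p - 1) x
      - (1 / 2) * ((2 * p - 1 : ℕ) : ℝ) * (sigma G ^ 2)⁻¹ * cmom G (2 * p - 1) * funA G 2 x)

/-- The function `C(p) = σ^{-2p} (A(2p) - p σ^{-2} μ_{2p} A(2))`. -/
def funC (G : Measure ℝ) (p : ℕ) (x : ℝ) : ℝ :=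
  (sigma G ^ (2 * p))⁻¹ *
    (funA G (2 * p) x - (p : ℝ) * (sigma G ^ 2)⁻¹ * cmom G (2 * p) * funA G 2 x)

/-- `aj(p)`, the variance of `C(p)` under `G`. -/
def aj (G : Measure ℝ) (p : ℕ) : ℝ := Var[funC G p; G]

/-- `bj(p)`, the variance of `B(p)` under `G`. -/
def bj (G : Measure ℝ) (p : ℕ) : ℝ := Var[funB G p; G]

/-- `abj(p)`, the covariance of `C(p)` and `B(p)` under `G`. -/
def abj (G : Measure ℝ) (p : ℕ) : ℝ := cov[funC G p, funB G p; G]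

/-- `Δ(p) = aj(p) bj(p) - abj(p)^2`. -/
def Delta (G : Measure ℝ) (p : ℕ) : ℝ := aj G p * bj G p - abj G p ^ 2

/-- The quadratic form of the general chi-square test. -/
def chiSquareStat (G : Measure ℝ) (x : ℕ → ℝ) (n p : ℕ) : ℝ :=
  (n : ℝ) / Delta G p *
    (aj G p * (bEmp x n p - bCoef G p) ^ 2
      + bj G p * (aEmp x n p - aCoef G p) ^ 2
      - 2 * abj G p * (bEmp x n p - bCoef G p) * (aEmp x n p - aCoef G p))

/-- The chi-square law with `d` degrees of freedom: the law of the sum of the squares of `d`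
independent standard normal random variables. -/
def chiSquared (d : ℕ) : Measure ℝ :=
  (Measure.pi fun _ : Fin d => gaussianReal 0 1).map fun z => ∑ i, z i ^ 2

instance instIsProbabilityMeasureChiSquared (d : ℕ) : IsProbabilityMeasure (chiSquared d) :=
  Measure.isProbabilityMeasure_map
    (Measurable.aemeasurable (Finset.measurable_sum _ fun i _ => (measurable_pi_apply i).pow_const 2))

end

end JarqueBera

/-! Empirical central moments are polynomials in empirical means of powers, so the delta method
turns the normalized coefficients into i.i.d. averages up to `o_P(1/√n)`: `√n (b_{n,p} - b_p)` and
`√n (a_{n,p} - a_p)` follow the normalized sums of `funB` and `funC`. `AsymptoticallyLinear` records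
such an expansion; `AsymptoticallyLinear.comp₂` gives its calculus, whence
`asymptoticallyLinear_bEmp` and `asymptoticallyLinear_aEmp`.

The statistic is `n` times the quadratic form of the inverse covariance matrix of (`funB`, `funC`).
Gram–Schmidt diagonalizes it: with `funC` replaced by its residual after regression on `funB`, and
both normalized, the form is a sum of two squares whose influence functions are uncorrelated with
variance one. The bivariate central limit theorem (by Cramér–Wold), Slutsky's lemma and continuous
mapping then give the limit, in `AsymptoticallyLinear.tendstoInDistribution_sum_sq`. -/

namespace JarqueBera

/-! ### Boundedness and convergence in probability, and the delta method. -/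

section InProbability

variable {Ω E F : Type*} [MeasurableSpace Ω] {P : Measure Ω}

lemma tendstoInMeasure_zero_of_norm_le_add {E₁ E₂ E₃ : Type*} [SeminormedAddCommGroup E₁]
    [SeminormedAddCommGroup E₂] [SeminormedAddCommGroup E₃] {A : ℕ → Ω → E₁} {B : ℕ → Ω → E₂}
    {C : ℕ → Ω → E₃} (hA : TendstoInMeasure P A atTop (fun _ => 0))
    (hB : TendstoInMeasure P B atTop (fun _ => 0)) (c : ℝ)
    (h : ∀ (n : ℕ) ω, ‖C n ω‖ ≤ c * (‖A n ω‖ + ‖B n ω‖)) :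
    TendstoInMeasure P C atTop (fun _ => 0) := by
  rw [tendstoInMeasure_iff_norm] at *
  simp only [sub_zero] at *
  intro ε hε
  -- `c` may be zero or negative, hence `|c| + 1` as a positive majorant.
  have hc : 0 < |c| + 1 := by positivity
  have hδ : 0 < ε / (2 * (|c| + 1)) := by positivity
  have hlim := (hA _ hδ).add (hB _ hδ)
  rw [add_zero] at hlim
  refine tendsto_of_tendsto_of_tendsto_of_le_of_le tendsto_const_nhds hlim (fun _ => zero_le) ?_
  intro n
  refine (measure_mono ?_).trans (measure_union_le _ _)
  intro ω hω
  by_contra hcon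
  simp only [Set.mem_union, Set.mem_ofPred_eq, not_or, not_le] at hcon hω
  have h1 : ‖A n ω‖ + ‖B n ω‖ < ε / (|c| + 1) := by
    calc ‖A n ω‖ + ‖B n ω‖ < ε / (2 * (|c| + 1)) + ε / (2 * (|c| + 1)) := add_lt_add hcon.1 hcon.2
      _ = ε / (|c| + 1) := by field_simp; ring
  have h2 : (|c| + 1) * (‖A n ω‖ + ‖B n ω‖) < ε := by
    rwa [lt_div_iff₀ hc, mul_comm] at h1
  have h3 : c * (‖A n ω‖ + ‖B n ω‖) ≤ (|c| + 1) * (‖A n ω‖ + ‖B n ω‖) := by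
    gcongr
    linarith [le_abs_self c]
  linarith [h n ω]

/-- Boundedness in probability of a sequence. -/
def BoundedInProb [Norm E] (P : Measure Ω) (A : ℕ → Ω → E) : Prop :=
  ∀ ε : ENNReal, 0 < ε → ∃ K : ℝ, 0 < K ∧ ∀ᶠ n in atTop, P {ω | K ≤ ‖A n ω‖} ≤ ε

lemma BoundedInProb.of_norm_le_add {E₁ E₂ E₃ : Type*} [SeminormedAddCommGroup E₁]
    [SeminormedAddCommGroup E₂] [SeminormedAddCommGroup E₃] {A : ℕ → Ω → E₁} {B : ℕ → Ω → E₂}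
    {C : ℕ → Ω → E₃} (hA : BoundedInProb P A) (hB : BoundedInProb P B)
    (h : ∀ (n : ℕ) ω, ‖C n ω‖ ≤ ‖A n ω‖ + ‖B n ω‖) : BoundedInProb P C := by
  intro ε hε
  obtain ⟨K, hK, hAK⟩ := hA (ε / 2) (ENNReal.half_pos hε.ne')
  obtain ⟨L, hL, hBL⟩ := hB (ε / 2) (ENNReal.half_pos hε.ne')
  refine ⟨K + L, by positivity, ?_⟩
  filter_upwards [hAK, hBL] with n h1 h2
  calc P {ω | K + L ≤ ‖C n ω‖} ≤ P ({ω | K ≤ ‖A n ω‖} ∪ {ω | L ≤ ‖B n ω‖}) := by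
        refine measure_mono fun ω hω => ?_
        by_contra hcon
        simp only [Set.mem_union, Set.mem_ofPred_eq, not_or, not_le] at hcon hω
        linarith [h n ω]
    _ ≤ ε / 2 + ε / 2 := (measure_union_le _ _).trans (add_le_add h1 h2)
    _ = ε := ENNReal.add_halves ε

lemma BoundedInProb.of_tendstoInMeasure [SeminormedAddCommGroup E] {A : ℕ → Ω → E}
    (hA : TendstoInMeasure P A atTop (fun _ => 0)) : BoundedInProb P A := by
  intro ε hε
  rw [tendstoInMeasure_iff_norm] at hA
  refine ⟨1, one_pos, ?_⟩
  filter_upwards [(hA 1 one_pos).eventually_le_const hε] with n hn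
  simpa using hn

/-- The delta method: the remainder in a first-order expansion at `m` of a differentiable function
of an estimator of `m` is of order smaller than `1 / √n`. -/
theorem tendstoInMeasure_sqrt_smul_remainder [NormedAddCommGroup E] [NormedSpace ℝ E]
    [NormedAddCommGroup F] [NormedSpace ℝ F] {f : E → F} {f' : E →L[ℝ] F} {m : E}
    (hf : HasFDerivAt f f' m) {M : ℕ → Ω → E}
    (hM : BoundedInProb P (fun (n : ℕ) ω => √(n : ℝ) • (M n ω - m))) :
    TendstoInMeasure P (fun (n : ℕ) ω => √(n : ℝ) • (f (M n ω) - f m - f' (M n ω - m))) atTop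
      (fun _ => 0) := by
  rw [tendstoInMeasure_iff_norm]
  simp only [sub_zero]
  intro η hη
  rw [ENNReal.tendsto_nhds_zero]
  intro ε hε
  obtain ⟨K, hK, hbound⟩ := hM ε hε
  -- On the event `√n ‖M n - m‖ < K`, this constant makes the scaled remainder at most `η / 2`; once
  -- `√n ≥ K / δ`, the same event puts `M n` within `δ` of `m`.
  have hlo := hf.isLittleO.def (c := η / (2 * K)) (by positivity)
  obtain ⟨δ, hδ, hball⟩ := Metric.eventually_nhds_iff.1 hlo
  have hsqrt : Tendsto (fun n : ℕ => √(n : ℝ)) atTop atTop :=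
    Real.tendsto_sqrt_atTop.comp tendsto_natCast_atTop_atTop
  filter_upwards [hbound, hsqrt.eventually_ge_atTop (K / δ), hsqrt.eventually_gt_atTop 0]
    with n hn hlarge hpos
  refine (measure_mono fun ω hω => ?_).trans hn
  by_contra hcon
  simp only [Set.mem_ofPred_eq, not_le, norm_smul, Real.norm_eq_abs, abs_of_pos hpos] at hcon hω
  have hclose : dist (M n ω) m < δ := by
    rw [dist_eq_norm]
    have : K ≤ √(n : ℝ) * δ := by rwa [div_le_iff₀ hδ] at hlarge
    exact lt_of_mul_lt_mul_left (hcon.trans_le this) hpos.le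
  have hrem := hball hclose
  have : √(n : ℝ) * ‖f (M n ω) - f m - f' (M n ω - m)‖ ≤ η / (2 * K) * K := by
    calc √(n : ℝ) * ‖f (M n ω) - f m - f' (M n ω - m)‖
        ≤ √(n : ℝ) * (η / (2 * K) * ‖M n ω - m‖) := by gcongr
      _ = η / (2 * K) * (√(n : ℝ) * ‖M n ω - m‖) := by ring
      _ ≤ η / (2 * K) * K := by gcongr
  have h2 : η / (2 * K) * K = η / 2 := by field_simp
  linarith

end InProbability

/-! ### Asymptotically linear estimators -/

/-- The centered and normalized sum of `ψ (X 0), …, ψ (X (n - 1))`. -/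
noncomputable def normalizedSum {Ω : Type*} (G : Measure ℝ) (X : ℕ → Ω → ℝ) (ψ : ℝ → ℝ)
    (n : ℕ) (ω : Ω) : ℝ :=
  (√(n : ℝ))⁻¹ * ∑ i ∈ Finset.range n, (ψ (X i ω) - ∫ x, ψ x ∂G)

lemma normalizedSum_linear_comb {Ω : Type*} {G : Measure ℝ} [IsProbabilityMeasure G]
    {X : ℕ → Ω → ℝ} {ψ φ : ℝ → ℝ} (hψ : MemLp ψ 2 G)
    (hφ : MemLp φ 2 G) (c d : ℝ) (n : ℕ) (ω : Ω) :
    normalizedSum G X (fun x => c * ψ x + d * φ x) n ω =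
      c * normalizedSum G X ψ n ω + d * normalizedSum G X φ n ω := by
  have hψ1 := hψ.integrable one_le_two
  have hφ1 := hφ.integrable one_le_two
  unfold normalizedSum
  rw [integral_add (hψ1.const_mul c) (hφ1.const_mul d), integral_const_mul, integral_const_mul]
  simp only [Finset.sum_sub_distrib, Finset.sum_add_distrib, ← Finset.mul_sum, Finset.sum_const]
  ring

section AsymptoticallyLinear

variable {Ω : Type*} [MeasurableSpace Ω] {P : Measure Ω} {G : Measure ℝ} {X : ℕ → Ω → ℝ}

/-- `T` is an asymptotically linear estimator of `θ` with influence function `ψ`. -/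
structure AsymptoticallyLinear (P : Measure Ω) (G : Measure ℝ) (X : ℕ → Ω → ℝ) (T : ℕ → Ω → ℝ)
    (θ : ℝ) (ψ : ℝ → ℝ) : Prop where
  memLp : MemLp ψ 2 G
  tendsto : TendstoInMeasure P (fun (n : ℕ) ω => √(n : ℝ) * (T n ω - θ) - normalizedSum G X ψ n ω) atTop
    (fun _ => 0)

lemma memLp_comp_of_hasLaw (hlaw : ∀ i, HasLaw (X i) G P) {ψ : ℝ → ℝ} (hψ : MemLp ψ 2 G) (i : ℕ) :
    MemLp (fun ω => ψ (X i ω)) 2 P := by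
  rw [← (hlaw i).map_eq] at hψ
  exact hψ.comp_of_map (hlaw i).aemeasurable

lemma integral_comp_of_hasLaw (hlaw : ∀ i, HasLaw (X i) G P) {ψ : ℝ → ℝ} (hψ : MemLp ψ 2 G)
    (i : ℕ) : ∫ ω, ψ (X i ω) ∂P = ∫ x, ψ x ∂G :=
  (hlaw i).integral_comp hψ.aestronglyMeasurable

lemma aemeasurable_normalizedSum (hlaw : ∀ i, HasLaw (X i) G P) {ψ : ℝ → ℝ} (hψ : MemLp ψ 2 G)
    (n : ℕ) : AEMeasurable (normalizedSum G X ψ n) P := by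
  refine AEMeasurable.const_mul (Finset.aemeasurable_fun_sum _ fun i _ => ?_) _
  exact (memLp_comp_of_hasLaw hlaw hψ i).aemeasurable.sub_const _

lemma iIndepFun_comp_of_aemeasurable (hlaw : ∀ i, HasLaw (X i) G P) (hindep : iIndepFun X P)
    {ψ : ℝ → ℝ} (hψ : AEMeasurable ψ G) : iIndepFun (fun i ω => ψ (X i ω)) P := by
  exact hindep.comp₀ (fun _ => ψ) (fun i => (hlaw i).aemeasurable)
    (fun i => by rw [(hlaw i).map_eq]; exact hψ)

/-- Chebyshev: by independence the variance of the normalized sum is `Var[ψ; G]` for every `n > 0`,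
so the tail bound is uniform in `n`. -/
lemma boundedInProb_normalizedSum [IsProbabilityMeasure P] (hlaw : ∀ i, HasLaw (X i) G P) (hindep : iIndepFun X P)
    {ψ : ℝ → ℝ} (hψ : MemLp ψ 2 G) : BoundedInProb P (normalizedSum G X ψ) := by
  have hL (i : ℕ) := memLp_comp_of_hasLaw hlaw hψ i
  have hind := iIndepFun_comp_of_aemeasurable hlaw hindep hψ.aemeasurable
  have hvar (n : ℕ) (hn : 0 < n) (K : ℝ) (hK : 0 < K) :
      P {ω | K ≤ ‖normalizedSum G X ψ n ω‖} ≤ ENNReal.ofReal (Var[ψ; G] / K ^ 2) := by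
    have hn' : (0 : ℝ) < n := by exact_mod_cast hn
    have hs : 0 < √(n : ℝ) := Real.sqrt_pos.2 hn'
    have hLs : MemLp (∑ i ∈ Finset.range n, fun ω => ψ (X i ω)) 2 P :=
      memLp_finsetSum' _ fun i _ => hL i
    have h := meas_ge_le_variance_div_sq hLs (c := √(n : ℝ) * K) (by positivity)
    rw [IndepFun.variance_sum (fun i _ => hL i)
      (fun i _ j _ hij => hind.indepFun hij)] at h
    have hv (i : ℕ) : Var[fun ω => ψ (X i ω); P] = Var[ψ; G] := by
      have := variance_map (X := ψ) (Y := X i) (μ := P)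
        (by rw [(hlaw i).map_eq]; exact hψ.aemeasurable) (hlaw i).aemeasurable
      rw [(hlaw i).map_eq] at this
      exact this.symm
    have hsum : P[∑ i ∈ Finset.range n, fun ω => ψ (X i ω)] = n * ∫ x, ψ x ∂G := by
      simp only [Finset.sum_apply]
      rw [integral_finsetSum _ fun i _ => (hL i).integrable one_le_two]
      simp [integral_comp_of_hasLaw hlaw hψ]
    simp only [hv, hsum, Finset.sum_const, Finset.card_range, nsmul_eq_mul] at h
    convert h using 2
    · ext ω
      simp only [normalizedSum, Set.mem_ofPred_eq, Real.norm_eq_abs, abs_mul, abs_inv,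
        abs_of_pos hs, Finset.sum_sub_distrib, Finset.sum_apply, Finset.sum_const,
        Finset.card_range, nsmul_eq_mul]
      rw [← div_eq_inv_mul, le_div_iff₀ hs, mul_comm]
    · rw [mul_pow, Real.sq_sqrt hn'.le]
      field_simp
  intro ε hε
  have hlim : Tendsto (fun K : ℝ => ENNReal.ofReal (Var[ψ; G] / K ^ 2)) atTop (nhds 0) := by
    rw [← ENNReal.ofReal_zero]
    exact ENNReal.tendsto_ofReal (tendsto_const_nhds.div_atTop (tendsto_pow_atTop two_ne_zero))
  obtain ⟨K, h1, h2⟩ := ((hlim.eventually_le_const hε).and (eventually_gt_atTop 0)).exists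
  refine ⟨K, h2, ?_⟩
  filter_upwards [eventually_gt_atTop 0] with n hn
  exact (hvar n hn K h2).trans h1

namespace AsymptoticallyLinear

variable {T S : ℕ → Ω → ℝ} {θ η : ℝ} {ψ φ : ℝ → ℝ}

lemma boundedInProb [IsProbabilityMeasure P] (hlaw : ∀ i, HasLaw (X i) G P) (hindep : iIndepFun X P)
    (hT : AsymptoticallyLinear P G X T θ ψ) :
    BoundedInProb P (fun (n : ℕ) ω => √(n : ℝ) * (T n ω - θ)) := by
  refine (BoundedInProb.of_tendstoInMeasure hT.tendsto).of_norm_le_add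
    (boundedInProb_normalizedSum hlaw hindep hT.memLp) fun (n : ℕ) ω => ?_
  simpa using norm_add_le (√(n : ℝ) * (T n ω - θ) - normalizedSum G X ψ n ω)
    (normalizedSum G X ψ n ω)

/-- The delta method for asymptotically linear estimators. -/
theorem comp₂ [IsProbabilityMeasure P] [IsProbabilityMeasure G]
    (hlaw : ∀ i, HasLaw (X i) G P) (hindep : iIndepFun X P)
    (hT : AsymptoticallyLinear P G X T θ ψ) (hS : AsymptoticallyLinear P G X S η φ)
    {f : ℝ × ℝ → ℝ} {f' : ℝ × ℝ →L[ℝ] ℝ} (hf : HasFDerivAt f f' (θ, η)) :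
    AsymptoticallyLinear P G X (fun n ω => f (T n ω, S n ω)) (f (θ, η))
      (fun x => f' (ψ x, φ x)) := by
  have hf' (x y : ℝ) : f' (x, y) = f' (1, 0) * x + f' (0, 1) * y := by
    have : ((x, y) : ℝ × ℝ) = x • (1, 0) + y • (0, 1) := by simp
    rw [this, map_add, map_smul, map_smul]
    simp [mul_comm]
  simp only [hf' (ψ _)]
  refine ⟨(hT.memLp.const_mul _).add (hS.memLp.const_mul _), ?_⟩
  have hb : BoundedInProb P (fun (n : ℕ) ω => √(n : ℝ) • ((T n ω, S n ω) - (θ, η))) := by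
    refine (hT.boundedInProb hlaw hindep).of_norm_le_add (hS.boundedInProb hlaw hindep)
      fun (n : ℕ) ω => ?_
    simp only [Prod.mk_sub_mk, Prod.smul_mk, smul_eq_mul]
    exact max_le_add_of_nonneg (norm_nonneg _) (norm_nonneg _)
  have hlin := tendstoInMeasure_zero_of_norm_le_add hT.tendsto hS.tendsto
    (|f' (1, 0)| + |f' (0, 1)|)
    (C := fun (n : ℕ) ω => f' (1, 0) * (√(n : ℝ) * (T n ω - θ) - normalizedSum G X ψ n ω)
      + f' (0, 1) * (√(n : ℝ) * (S n ω - η) - normalizedSum G X φ n ω)) (fun n ω => by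
      refine (norm_add_le _ _).trans ?_
      simp only [norm_mul, Real.norm_eq_abs]
      have h1 := abs_nonneg (f' (1, 0))
      have h2 := abs_nonneg (f' (0, 1))
      nlinarith [mul_nonneg h1 (abs_nonneg (√(n : ℝ) * (S n ω - η) - normalizedSum G X φ n ω)),
        mul_nonneg h2 (abs_nonneg (√(n : ℝ) * (T n ω - θ) - normalizedSum G X ψ n ω))])
  -- The error is the Taylor remainder of `f` plus `f'` applied to the two linearization errors.
  refine tendstoInMeasure_zero_of_norm_le_add (tendstoInMeasure_sqrt_smul_remainder hf hb) hlin 1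
    fun (n : ℕ) ω => ?_
  rw [one_mul]
  refine le_of_eq_of_le (congrArg _ ?_) (norm_add_le _ _)
  rw [normalizedSum_linear_comb hT.memLp hS.memLp, Prod.mk_sub_mk, hf' (T n ω - θ), smul_eq_mul]
  ring

lemma mul [IsProbabilityMeasure P] [IsProbabilityMeasure G]
    (hlaw : ∀ i, HasLaw (X i) G P) (hindep : iIndepFun X P)
    (hT : AsymptoticallyLinear P G X T θ ψ) (hS : AsymptoticallyLinear P G X S η φ) :
    AsymptoticallyLinear P G X (fun n ω => T n ω * S n ω) (θ * η)
      (fun x => θ * φ x + η * ψ x) := by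
  simpa using hT.comp₂ hlaw hindep hS
    ((hasFDerivAt_fst (𝕜 := ℝ) (p := (θ, η))).mul (hasFDerivAt_snd (𝕜 := ℝ) (p := (θ, η))))

/-- The two-variable delta method with `T` in both slots and a function of the first coordinate
only. -/
lemma comp [IsProbabilityMeasure P] [IsProbabilityMeasure G]
    (hlaw : ∀ i, HasLaw (X i) G P) (hindep : iIndepFun X P)
    (hT : AsymptoticallyLinear P G X T θ ψ) {g : ℝ → ℝ} {g' : ℝ} (hg : HasDerivAt g g' θ) :
    AsymptoticallyLinear P G X (fun n ω => g (T n ω)) (g θ) (fun x => g' * ψ x) := by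
  simpa [mul_comm] using hT.comp₂ hlaw hindep hT
    (hg.hasFDerivAt.comp (θ, θ) (hasFDerivAt_fst (𝕜 := ℝ) (p := (θ, θ))))

lemma linear_comb [IsProbabilityMeasure G] (hT : AsymptoticallyLinear P G X T θ ψ)
    (hS : AsymptoticallyLinear P G X S η φ) (c d : ℝ) :
    AsymptoticallyLinear P G X (fun n ω => c * T n ω + d * S n ω) (c * θ + d * η)
      (fun x => c * ψ x + d * φ x) := by
  refine ⟨(hT.memLp.const_mul _).add (hS.memLp.const_mul _), ?_⟩
  refine tendstoInMeasure_zero_of_norm_le_add hT.tendsto hS.tendsto (|c| + |d|) (fun (n : ℕ) ω => ?_)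
  rw [normalizedSum_linear_comb hT.memLp hS.memLp]
  have : √(n : ℝ) * (c * T n ω + d * S n ω - (c * θ + d * η)) -
      (c * normalizedSum G X ψ n ω + d * normalizedSum G X φ n ω) =
      c * (√(n : ℝ) * (T n ω - θ) - normalizedSum G X ψ n ω)
      + d * (√(n : ℝ) * (S n ω - η) - normalizedSum G X φ n ω) := by ring
  rw [this]
  refine (norm_add_le _ _).trans ?_
  simp only [norm_mul, Real.norm_eq_abs]
  have h1 := abs_nonneg c
  have h2 := abs_nonneg d
  nlinarith [mul_nonneg h1 (abs_nonneg (√(n : ℝ) * (S n ω - η) - normalizedSum G X φ n ω)),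
    mul_nonneg h2 (abs_nonneg (√(n : ℝ) * (T n ω - θ) - normalizedSum G X ψ n ω))]

lemma zero : AsymptoticallyLinear P G X (fun _ _ => 0) 0 (fun _ => 0) := by
  refine ⟨MemLp.zero, ?_⟩
  simp only [normalizedSum]
  simp [tendstoInMeasure_iff_norm]
  intro ε hε
  simp [hε.not_ge]

lemma sum [IsProbabilityMeasure G] {T : ℕ → ℕ → Ω → ℝ} {θ : ℕ → ℝ} {ψ : ℕ → ℝ → ℝ}
    (s : Finset ℕ) (c : ℕ → ℝ) (hT : ∀ q ∈ s, AsymptoticallyLinear P G X (T q) (θ q) (ψ q)) :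
    AsymptoticallyLinear P G X (fun n ω => ∑ q ∈ s, c q * T q n ω) (∑ q ∈ s, c q * θ q)
      (fun x => ∑ q ∈ s, c q * ψ q x) := by
  induction s using Finset.induction_on with
  | empty => simpa using zero
  | insert a s ha ih =>
    simp only [Finset.sum_insert ha]
    have h := (hT a (Finset.mem_insert_self a s)).linear_comb
      (ih fun q hq => hT q (Finset.mem_insert_of_mem hq)) (c a) 1
    simpa using h

/-- Here the linearization is exact, also at `n = 0`, where both sides vanish by the conventions for
division by zero. -/
lemma mean (hψ : MemLp ψ 2 G) :
    AsymptoticallyLinear P G X (fun (n : ℕ) ω => (1 / (n : ℝ)) * ∑ i ∈ Finset.range n, ψ (X i ω))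
      (∫ x, ψ x ∂G) ψ := by
  refine ⟨hψ, ?_⟩
  have h0 (n : ℕ) (ω : Ω) : √(n : ℝ) * ((1 / (n : ℝ)) * ∑ i ∈ Finset.range n, ψ (X i ω)
      - ∫ x, ψ x ∂G) - normalizedSum G X ψ n ω = 0 := by
    unfold normalizedSum
    rcases Nat.eq_zero_or_pos n with rfl | hn
    · simp
    · have hn' : (0 : ℝ) < n := by exact_mod_cast hn
      have hs : 0 < √(n : ℝ) := Real.sqrt_pos.2 hn'
      simp only [Finset.sum_sub_distrib, Finset.sum_const, Finset.card_range, nsmul_eq_mul]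
      have hsq := Real.sq_sqrt hn'.le
      set s := √(n : ℝ)
      rw [← hsq]
      field_simp
      ring
  simp only [h0, tendstoInMeasure_iff_norm]
  intro ε hε
  simp [hε.not_ge]

end AsymptoticallyLinear

end AsymptoticallyLinear

/-! ### The influence functions of the empirical coefficients -/

section Estimators

variable {Ω : Type*} [MeasurableSpace Ω] {P : Measure Ω} {G : Measure ℝ} {X : ℕ → Ω → ℝ}

lemma integral_pow_eq_mom (q : ℕ) : ∫ x, x ^ q ∂G = mom G q := by
  simp [mom, moment]

lemma cmom_two : cmom G 2 = Var[id; G] := by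
  rw [cmom, centralMoment_two_eq_variance aemeasurable_id]

variable [IsProbabilityMeasure G]

lemma memLp_two_pow {N : ℕ} (hmom : Integrable (fun x : ℝ => x ^ (2 * N)) G) {q : ℕ} (hq : q ≤ N) :
    MemLp (fun x : ℝ => x ^ q) 2 G := by
  rw [memLp_two_iff_integrable_sq (by fun_prop)]
  refine ((integrable_const (1 : ℝ)).add hmom).mono' (by fun_prop) (ae_of_all _ fun x => ?_)
  simp only [Pi.add_apply, ← pow_mul, mul_comm q 2]
  rw [Real.norm_eq_abs, abs_pow, pow_mul |x|, pow_mul x, sq_abs]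
  -- Domination `x ^ (2 * q) ≤ 1 + x ^ (2 * N)`, according to whether `x ^ 2 ≤ 1`.
  have hx := sq_nonneg x
  rcases le_total (x ^ 2) 1 with h | h
  · have := pow_le_one₀ (n := q) hx h
    have := pow_nonneg hx N
    linarith
  · have := pow_le_pow_right₀ h hq
    linarith

lemma cmom_eq_sum {N : ℕ} (hmom : Integrable (fun x : ℝ => x ^ (2 * N)) G) {l : ℕ} (hl : l ≤ N) :
    cmom G l = ∑ q ∈ Finset.range (l + 1), (l.choose q : ℝ) * (-1) ^ (l - q) *
      (mom G q * mom G 1 ^ (l - q)) := by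
  have h1 : cmom G l = ∫ x, (x - mom G 1) ^ l ∂G := by
    simp [cmom, centralMoment, mom, moment]
  rw [h1]
  simp only [sub_eq_add_neg, add_pow]
  rw [integral_finsetSum]
  · refine Finset.sum_congr rfl fun q _ => ?_
    rw [integral_mul_const, integral_mul_const, integral_pow_eq_mom, neg_pow]
    ring
  · intro q hq
    have hq' : q ≤ N := (Finset.mem_range_succ_iff.1 hq).trans hl
    exact (((memLp_two_pow hmom hq').integrable one_le_two).mul_const _).mul_const _

/-- The same polynomial as in `cmom_eq_sum`, with empirical means for moments. The exponent `1` is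
kept so that the mean appears as the case `q = 1` of the power means. -/
lemma sampleCentralMoment_eq_sum (x : ℕ → ℝ) (n l : ℕ) :
    sampleCentralMoment x n l = ∑ q ∈ Finset.range (l + 1), (l.choose q : ℝ) * (-1) ^ (l - q) *
      ((1 / (n : ℝ) * ∑ i ∈ Finset.range n, x i ^ q) *
        (1 / (n : ℝ) * ∑ i ∈ Finset.range n, x i ^ 1) ^ (l - q)) := by
  simp only [pow_one]
  change _ = ∑ q ∈ Finset.range (l + 1), (l.choose q : ℝ) * (-1) ^ (l - q) *
      ((1 / (n : ℝ) * ∑ i ∈ Finset.range n, x i ^ q) * sampleMean x n ^ (l - q))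
  unfold sampleCentralMoment
  simp only [sub_eq_add_neg (x _), add_pow]
  rw [Finset.sum_comm, Finset.mul_sum]
  refine Finset.sum_congr rfl fun q _ => ?_
  rw [← Finset.sum_mul, ← Finset.sum_mul, neg_pow]
  ring

variable [IsProbabilityMeasure P]

theorem asymptoticallyLinear_sampleCentralMoment (hlaw : ∀ i, HasLaw (X i) G P)
    (hindep : iIndepFun X P) {N : ℕ} (hN : 1 ≤ N)
    (hmom : Integrable (fun x : ℝ => x ^ (2 * N)) G) {l : ℕ} (hl : l ≤ N) :
    AsymptoticallyLinear P G X (fun n ω => sampleCentralMoment (fun i => X i ω) n l) (cmom G l)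
      (funA G l) := by
  have hmean (q : ℕ) (hq : q ≤ N) := AsymptoticallyLinear.mean (P := P) (X := X)
    (memLp_two_pow hmom hq)
  have hsum := AsymptoticallyLinear.sum (Finset.range (l + 1))
    (fun q => (l.choose q : ℝ) * (-1) ^ (l - q))
    fun q hq => (hmean q ((Finset.mem_range_succ_iff.1 hq).trans hl)).mul hlaw hindep
      ((hmean 1 hN).comp hlaw hindep (hasDerivAt_pow (l - q) _))
  simp only [integral_pow_eq_mom] at hsum
  simp only [sampleCentralMoment_eq_sum, cmom_eq_sum hmom hl]
  convert hsum using 2 with x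
  -- The term `q = l` yields `x ^ l` alone: its part along `h_1` carries the factor `l - q = 0`.
  rw [Finset.sum_range_succ, funA]
  simp only [Nat.sub_self, pow_zero, Nat.choose_self, Nat.cast_one, Nat.cast_zero]
  rw [add_comm]
  congr 1
  · refine Finset.sum_congr rfl fun q _ => ?_
    ring
  · ring

/-- The derivative is written as the function times its logarithmic derivative, so that the common
factor of `funB` comes out directly. -/
lemma hasDerivAt_inv_sqrt_pow {v : ℝ} (hv : 0 < v) (j : ℕ) :
    HasDerivAt (fun v : ℝ => (√v ^ j)⁻¹) (-((j : ℝ) / 2 * v⁻¹ * (√v ^ j)⁻¹)) v := by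
  have hs : 0 < √v := Real.sqrt_pos.2 hv
  refine (((Real.hasDerivAt_sqrt hv.ne').fun_pow j).fun_inv (by positivity)).congr_deriv ?_
  obtain _ | i := j
  · simp
  · have hsq := Real.sq_sqrt hv.le
    set s := √v
    rw [← hsq]
    simp only [Nat.add_sub_cancel]
    field_simp
    ring

lemma hasDerivAt_inv_pow {v : ℝ} (hv : 0 < v) (j : ℕ) :
    HasDerivAt (fun v : ℝ => (v ^ j)⁻¹) (-((j : ℝ) * v⁻¹ * (v ^ j)⁻¹)) v := by
  refine ((hasDerivAt_pow j v).fun_inv (by positivity)).congr_deriv ?_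
  obtain _ | i := j
  · simp
  · simp only [Nat.add_sub_cancel]
    field_simp
    ring

/-- Product rule for the numerator times the inverse power of the sample variance. Only
differentiability at the true variance, which is positive, matters, so the value at zero sample
variance is harmless. -/
theorem asymptoticallyLinear_bEmp (hlaw : ∀ i, HasLaw (X i) G P) (hindep : iIndepFun X P)
    {p : ℕ} (hp : 1 ≤ p) (hmom : Integrable (fun x : ℝ => x ^ (2 * (2 * p))) G)
    (hvar : 0 < Var[id; G]) :
    AsymptoticallyLinear P G X (fun n ω => bEmp (fun i => X i ω) n p) (bCoef G p) (funB G p) := by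
  have hv : 0 < cmom G 2 := by rwa [cmom_two]
  have h := (asymptoticallyLinear_sampleCentralMoment hlaw hindep (by omega) hmom
    (l := 2 * p - 1) (by omega)).mul hlaw hindep
    ((asymptoticallyLinear_sampleCentralMoment hlaw hindep (by omega) hmom (l := 2)
      (by omega)).comp hlaw hindep (hasDerivAt_inv_sqrt_pow hv (2 * p - 1)))
  simp only [bEmp, bCoef, div_eq_mul_inv, sigma]
  convert h using 2 with x
  rw [funB, sigma, Real.sq_sqrt hv.le]
  ring

theorem asymptoticallyLinear_aEmp (hlaw : ∀ i, HasLaw (X i) G P) (hindep : iIndepFun X P)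
    {p : ℕ} (hp : 1 ≤ p) (hmom : Integrable (fun x : ℝ => x ^ (2 * (2 * p))) G)
    (hvar : 0 < Var[id; G]) :
    AsymptoticallyLinear P G X (fun n ω => aEmp (fun i => X i ω) n p) (aCoef G p) (funC G p) := by
  have hv : 0 < cmom G 2 := by rwa [cmom_two]
  have h := (asymptoticallyLinear_sampleCentralMoment hlaw hindep (by omega) hmom
    (l := 2 * p) le_rfl).mul hlaw hindep
    ((asymptoticallyLinear_sampleCentralMoment hlaw hindep (by omega) hmom (l := 2)
      (by omega)).comp hlaw hindep (hasDerivAt_inv_pow hv p))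
  simp only [aEmp, aCoef, div_eq_mul_inv, sigma, pow_mul √(cmom G 2), Real.sq_sqrt hv.le]
  convert h using 2 with x
  rw [funC, sigma, pow_mul, Real.sq_sqrt hv.le]
  ring

end Estimators

/-! ### The bivariate central limit theorem -/

section CentralLimit

variable {Ω : Type*} [MeasurableSpace Ω] {P : Measure Ω} [IsProbabilityMeasure P] {G : Measure ℝ}
  {X : ℕ → Ω → ℝ}

/-- The argument `1` suffices for Cramér–Wold, since `ψ` will range over all linear combinations of
two influence functions. -/
lemma tendsto_charFun_normalizedSum (hlaw : ∀ i, HasLaw (X i) G P) (hindep : iIndepFun X P)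
    {ψ : ℝ → ℝ} (hψ : MemLp ψ 2 G) :
    Tendsto (fun n => charFun (P.map (normalizedSum G X ψ n)) 1) atTop
      (nhds (Complex.exp (-(Var[ψ; G] : ℝ) / 2))) := by
  have hident (i : ℕ) : IdentDistrib (fun ω => ψ (X i ω)) (fun ω => ψ (X 0 ω)) P P := by
    have h : IdentDistrib (X i) (X 0) P P :=
      ⟨(hlaw i).aemeasurable, (hlaw 0).aemeasurable, by rw [(hlaw i).map_eq, (hlaw 0).map_eq]⟩
    exact h.comp_of_aemeasurable (by rw [(hlaw i).map_eq]; exact hψ.aemeasurable)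
  have hclt := tendstoInDistribution_inv_sqrt_mul_sum_sub (P := P)
    (X := fun i ω => ψ (X i ω)) HasLaw.id (memLp_comp_of_hasLaw hlaw hψ 0)
    (iIndepFun_comp_of_aemeasurable hlaw hindep hψ.aemeasurable) hident
  have hvar : Var[fun ω => ψ (X 0 ω); P] = Var[ψ; G] := by
    have := variance_map (X := ψ) (Y := X 0) (μ := P)
      (by rw [(hlaw 0).map_eq]; exact hψ.aemeasurable) (hlaw 0).aemeasurable
    rw [(hlaw 0).map_eq] at this
    exact this.symm
  have hlim := ProbabilityMeasure.tendsto_iff_tendsto_charFun.1 hclt.tendsto 1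
  simp only [ProbabilityMeasure.coe_mk, Measure.map_id, charFun_gaussianReal, hvar,
    integral_comp_of_hasLaw hlaw hψ] at hlim
  convert hlim using 2 with n
  · congr 2
    ext ω
    simp [normalizedSum, Finset.sum_sub_distrib]
  · simp [variance_nonneg, neg_div]

theorem tendstoInDistribution_normalizedSum_pair [IsProbabilityMeasure G]
    (hlaw : ∀ i, HasLaw (X i) G P)
    (hindep : iIndepFun X P) {U V : ℝ → ℝ} (hU : MemLp U 2 G) (hV : MemLp V 2 G)
    (hvarU : Var[U; G] = 1) (hvarV : Var[V; G] = 1) (hcov : cov[U, V; G] = 0) :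
    TendstoInDistribution
      (fun n ω => !₂[normalizedSum G X U n ω, normalizedSum G X V n ω]) atTop
      (id : EuclideanSpace ℝ (Fin 2) → EuclideanSpace ℝ (Fin 2)) (fun _ => P)
      (stdGaussian (EuclideanSpace ℝ (Fin 2))) := by
  have hmeas (n : ℕ) : AEMeasurable (fun ω => !₂[normalizedSum G X U n ω, normalizedSum G X V n ω])
      P := by
    have h1 := aemeasurable_normalizedSum hlaw hU n
    have h2 := aemeasurable_normalizedSum hlaw hV n
    refine (WithLp.measurable_toLp 2 _).comp_aemeasurable (aemeasurable_pi_lambda _ fun i => ?_)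
    fin_cases i
    · exact h1
    · exact h2
  refine ⟨hmeas, aemeasurable_id, ProbabilityMeasure.tendsto_iff_tendsto_charFun.2 fun t => ?_⟩
  simp only [ProbabilityMeasure.coe_mk, Measure.map_id, charFun_stdGaussian]
  have hL : MemLp (fun x => t 0 * U x + t 1 * V x) 2 G := (hU.const_mul _).add (hV.const_mul _)
  have hlim := tendsto_charFun_normalizedSum hlaw hindep hL
  -- Orthonormality of `U` and `V` is what makes the limit the standard Gaussian.
  have hvar : Var[fun x => t 0 * U x + t 1 * V x; G] = ‖t‖ ^ 2 := by
    rw [variance_fun_add (hU.const_mul _) (hV.const_mul _), variance_const_mul, variance_const_mul,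
      covariance_const_mul_left, covariance_const_mul_right, hvarU, hvarV, hcov,
      EuclideanSpace.norm_sq_eq]
    simp
  rw [hvar] at hlim
  convert hlim using 2 with n
  · rw [charFun_apply, charFun_apply, integral_map (hmeas n) (by fun_prop),
      integral_map (aemeasurable_normalizedSum hlaw hL n) (by fun_prop)]
    refine integral_congr_ae (ae_of_all _ fun ω => ?_)
    simp only [normalizedSum_linear_comb hU hV, PiLp.inner_apply, Fin.sum_univ_two]
    simp
  · simp

end CentralLimit

/-! ### From the Gaussian limit to the chi-square law. -/

lemma stdGaussian_map_sum_sq :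
    (stdGaussian (EuclideanSpace ℝ (Fin 2))).map (fun x => x 0 ^ 2 + x 1 ^ 2) = chiSquared 2 := by
  rw [← map_pi_eq_stdGaussian, Measure.map_map (by fun_prop) (by fun_prop), chiSquared]
  congr 1
  ext z
  simp [Fin.sum_univ_two]

section ChiSquare

lemma aemeasurable_sampleCentralMoment {Ω : Type*} [MeasurableSpace Ω] {P : Measure Ω}
    {X : ℕ → Ω → ℝ} (hX : ∀ i, AEMeasurable (X i) P) (n l : ℕ) :
    AEMeasurable (fun ω => sampleCentralMoment (fun i => X i ω) n l) P := by
  unfold sampleCentralMoment sampleMean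
  fun_prop
variable {Ω : Type*} [MeasurableSpace Ω] {P : Measure Ω} [IsProbabilityMeasure P] {G : Measure ℝ}
  [IsProbabilityMeasure G] {X : ℕ → Ω → ℝ}

/-- Slutsky's lemma carries the bivariate limit from the normalized sums to the estimators; the
squared norm is continuous, and `n` is absorbed as `√n ^ 2`. -/
theorem AsymptoticallyLinear.tendstoInDistribution_sum_sq (hlaw : ∀ i, HasLaw (X i) G P)
    (hindep : iIndepFun X P) {T S : ℕ → Ω → ℝ} {θ η : ℝ} {U V : ℝ → ℝ}
    (hT : AsymptoticallyLinear P G X T θ U) (hS : AsymptoticallyLinear P G X S η V)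
    (hTm : ∀ n, AEMeasurable (T n) P) (hSm : ∀ n, AEMeasurable (S n) P)
    (hvarU : Var[U; G] = 1) (hvarV : Var[V; G] = 1) (hcov : cov[U, V; G] = 0) :
    TendstoInDistribution (fun (n : ℕ) ω => n * ((T n ω - θ) ^ 2 + (S n ω - η) ^ 2)) atTop
      (id : ℝ → ℝ) (fun _ => P) (chiSquared 2) := by
  have hdist := tendstoInDistribution_of_tendstoInMeasure_sub
    (fun (n : ℕ) ω => (!₂[√(n : ℝ) * (T n ω - θ), √(n : ℝ) * (S n ω - η)] :
      EuclideanSpace ℝ (Fin 2))) id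
    (tendstoInDistribution_normalizedSum_pair hlaw hindep hT.memLp hS.memLp hvarU hvarV hcov)
    (tendstoInMeasure_zero_of_norm_le_add hT.tendsto hS.tendsto 1 fun n ω => by
      rw [one_mul, EuclideanSpace.norm_eq]
      refine Real.sqrt_le_iff.2 ⟨by positivity, ?_⟩
      simp only [Fin.sum_univ_two, Pi.sub_apply, PiLp.sub_apply]
      simp only [Matrix.cons_val_zero, Matrix.cons_val_one]
      nlinarith [norm_nonneg (√(n : ℝ) * (T n ω - θ) - normalizedSum G X U n ω),
        norm_nonneg (√(n : ℝ) * (S n ω - η) - normalizedSum G X V n ω)])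
    (fun n => (WithLp.measurable_toLp 2 _).comp_aemeasurable (aemeasurable_pi_lambda _ fun i => by
      fin_cases i
      · exact ((hTm n).sub_const θ).const_mul _
      · exact ((hSm n).sub_const η).const_mul _))
  have hsq := hdist.continuous_comp (g := fun x => x 0 ^ 2 + x 1 ^ 2) (by fun_prop)
  have hfun (n : ℕ) : (fun x : EuclideanSpace ℝ (Fin 2) => x 0 ^ 2 + x 1 ^ 2) ∘
      (fun ω => !₂[√(n : ℝ) * (T n ω - θ), √(n : ℝ) * (S n ω - η)]) =
      fun ω => n * ((T n ω - θ) ^ 2 + (S n ω - η) ^ 2) := by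
    ext ω
    simp [mul_pow, mul_add]
  simp only [hfun] at hsq
  refine ⟨hsq.forall_aemeasurable, aemeasurable_id, ?_⟩
  convert hsq.tendsto using 2
  refine congrArg nhds (Subtype.ext ?_)
  simp only [Measure.map_id, Function.comp_id]
  exact stdGaussian_map_sum_sq.symm

lemma covariance_eq_zero_of_variance_eq_zero {f g : ℝ → ℝ} (hg : MemLp g 2 G)
    (h : Var[g; G] = 0) : cov[f, g; G] = 0 := by
  rw [covariance]
  refine integral_eq_zero_of_ae ?_
  filter_upwards [ae_eq_integral_of_variance_eq_zero hg h] with x hx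
  simp [hx]

lemma variance_sub_const_mul {f g : ℝ → ℝ} (hf : MemLp f 2 G) (hg : MemLp g 2 G) (c : ℝ) :
    Var[fun x => f x - c * g x; G] = Var[f; G] - 2 * c * cov[f, g; G] + c ^ 2 * Var[g; G] := by
  rw [variance_fun_sub hf (hg.const_mul c), covariance_const_mul_right, variance_const_mul]
  ring

end ChiSquare

end JarqueBera

open JarqueBera

theorem mainTheorem5 {Ω : Type*} [MeasurableSpace Ω] (P : Measure Ω) [IsProbabilityMeasure P]
    (G : Measure ℝ) [IsProbabilityMeasure G]
    (X : ℕ → Ω → ℝ) (hlaw : ∀ i, HasLaw (X i) G P) (hindep : iIndepFun X P)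
    (k : ℕ) (hk : 2 ≤ k) (hmom : Integrable (fun x : ℝ => x ^ (4 * k)) G)
    (hvar : 0 < Var[id; G])
    (p : ℕ) (hp : 2 ≤ p) (hpk : p ≤ k) (hDelta : JarqueBera.Delta G p ≠ 0) :
    TendstoInDistribution
      (fun (n : ℕ) (ω : Ω) => JarqueBera.chiSquareStat G (fun i => X i ω) n p)
      atTop (id : ℝ → ℝ) (fun _ => P) (JarqueBera.chiSquared 2) := by
  have hmom' : Integrable (fun x : ℝ => x ^ (2 * (2 * p))) G := by
    have h : MemLp (fun x : ℝ => x ^ (2 * p)) 2 G :=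
      memLp_two_pow (N := 2 * k) (by rwa [← mul_assoc]) (by omega)
    simpa only [← pow_mul, mul_comm _ 2] using h.integrable_sq
  have hB := asymptoticallyLinear_bEmp hlaw hindep (by omega) hmom' hvar
  have hC := asymptoticallyLinear_aEmp hlaw hindep (by omega) hmom' hvar
  -- A degenerate `funB` would also have zero covariance with `funC`, forcing `Delta` to vanish.
  have hbj : bj G p ≠ 0 := fun h => hDelta <| by
    simp [Delta, h, abj, covariance_eq_zero_of_variance_eq_zero hB.memLp h]
  have hbj_pos : 0 < bj G p := lt_of_le_of_ne (variance_nonneg _ _) hbj.symm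
  -- Regression coefficient of `funC` on `funB`: the residual is uncorrelated with `funB` and has
  -- variance `Delta / bj`, which also shows `Delta > 0`.
  set c := abj G p / bj G p with hc
  have hvarW : Var[fun x => funC G p x - c * funB G p x; G] = Delta G p / bj G p := by
    rw [variance_sub_const_mul hC.memLp hB.memLp]
    change aj G p - 2 * c * abj G p + c ^ 2 * bj G p = _
    rw [hc, Delta]
    field_simp
    ring
  have hDelta_pos : 0 < Delta G p := by
    have h : 0 ≤ Delta G p / bj G p := hvarW ▸ variance_nonneg _ _
    exact lt_of_le_of_ne (by simpa using (le_div_iff₀ hbj_pos).1 h) hDelta.symm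
  have hd_pos : 0 < Delta G p / bj G p := by positivity
  set u := (√(bj G p))⁻¹ with hu
  set v := (√(Delta G p / bj G p))⁻¹ with hv
  have hu2 : u ^ 2 = (bj G p)⁻¹ := by rw [hu, inv_pow, Real.sq_sqrt hbj_pos.le]
  have hv2 : v ^ 2 = (Delta G p / bj G p)⁻¹ := by rw [hv, inv_pow, Real.sq_sqrt hd_pos.le]
  have hmeas := aemeasurable_sampleCentralMoment (P := P) fun i => (hlaw i).aemeasurable
  have hbm (n : ℕ) : AEMeasurable (fun ω => bEmp (fun i => X i ω) n p) P :=
    (hmeas n _).div ((hmeas n 2).sqrt.pow_const _)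
  have ham (n : ℕ) : AEMeasurable (fun ω => aEmp (fun i => X i ω) n p) P :=
    (hmeas n _).div ((hmeas n 2).pow_const _)
  -- The whitened pair: `funB` and the residual `funC - c * funB`, each scaled to unit variance.
  have hU := hB.linear_comb hC u 0
  have hV := hB.linear_comb hC (-(v * c)) v
  have hlim := hU.tendstoInDistribution_sum_sq hlaw hindep hV
    (fun n => ((hbm n).const_mul _).add ((ham n).const_mul _))
    (fun n => ((hbm n).const_mul _).add ((ham n).const_mul _))
    (by
      simp only [zero_mul, add_zero]
      rw [variance_const_mul, hu2]
      exact inv_mul_cancel₀ hbj)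
    (by
      have : (fun x => -(v * c) * funB G p x + v * funC G p x) =
          fun x => v * (funC G p x - c * funB G p x) := by
        ext x; ring
      rw [this, variance_const_mul, hvarW, hv2]
      exact inv_mul_cancel₀ hd_pos.ne')
    (by
      have hbb : cov[funB G p, funB G p; G] = bj G p :=
        covariance_self hB.memLp.aemeasurable
      have hbc : cov[funB G p, funC G p; G] = abj G p := covariance_comm _ _
      simp only [zero_mul, add_zero]
      have hadd : (fun x => -(v * c) * funB G p x + v * funC G p x) =
          (fun x => -(v * c) * funB G p x) + fun x => v * funC G p x := rfl
      rw [covariance_const_mul_left, hadd, covariance_add_right hB.memLp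
        (hB.memLp.const_mul _) (hC.memLp.const_mul _), covariance_const_mul_right,
        covariance_const_mul_right, hbb, hbc, hc]
      field_simp
      ring)
  convert hlim using 3 with n ω
  set β := bEmp (fun i => X i ω) n p
  set α := aEmp (fun i => X i ω) n p
  have hU2 : (u * β + 0 * α - (u * bCoef G p + 0 * aCoef G p)) ^ 2 =
      (bj G p)⁻¹ * (β - bCoef G p) ^ 2 := by
    rw [← hu2]; ring
  have hV2 : (-(v * c) * β + v * α - (-(v * c) * bCoef G p + v * aCoef G p)) ^ 2 =
      (Delta G p / bj G p)⁻¹ * ((α - aCoef G p) - c * (β - bCoef G p)) ^ 2 := by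
    rw [← hv2]; ring
  -- Eliminating `aj` reduces the claim to completing the square in `α - aCoef G p`.
  have haj : aj G p = (Delta G p + abj G p ^ 2) / bj G p := by
    rw [Delta]
    field_simp
    ring
  rw [chiSquareStat, hU2, hV2, haj, hc]
  field_simp
  ring
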